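/- Let $X$ and $\Theta$ be Borel subsets of Polish spaces, with their Borel $\sigma$-algebras, and equip the sets $\mathcal M(X)$ and $\mathcal M(\Theta)$ of Borel probability measures with the topology of weak convergence (equivalently, of the Prokhorov metrics) and its Borel $\sigma$-algebra. Let $P:\Theta\to\mathcal M(X)$, $\theta\mapsto P_\theta$, be an injective measurable map which is dominated (there is a $\sigma$-finite Borel measure $\nu$ on $X$ with $P_\theta\ll\nu$ for all $\theta\in\Theta$) and open onto its image ($P:\Theta\to P(\Theta)$ is open, $P(\Theta)$ carrying the subspace topology of $\mathcal M(X)$). Let $\theta^*\in\Theta$ and let $\pi\in\mathcal M(\Theta)$ be a prior with Kullback–Leibler support at $\theta^*$, that is, $$\pi\bigl(\{\theta\in\Theta: K(P_{\theta^*},P_\theta)\le\varepsilon\}\bigr)>0\quad\text{for every }\varepsilon>0,$$ where $K(\mu_1,\mu_2)=\int\log\frac{d\mu_1}{d\mu_2}\,d\mu_1$ if $\mu_1\ll\mu_2$, and $K(\mu_1,\mu_2)=\infty$ otherwise. For each $n$ let $x^n\mapsto\pi_{x^n}$, $X^n\to\mathcal M(\Theta)$, be any version of the posterior, i.e. of the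 regular conditional distribution of $\theta$ given $x^n=(x_1,\dots,x_n)$ when $\theta\sim\pi$ and, given $\theta$, $x^n\sim P_\theta^{\,n}$. Then for every measurable neighborhood $U$ of $\theta^*$, $$\pi_{x^n}(U)\longrightarrow 1\quad\text{as } n\to\infty,\qquad\text{for } P_{\theta^*}^{\infty}\text{-almost every } x^\infty=(x_1,x_2,\dots)\in X^\infty .$$ -/

import Mathlib

open MeasureTheory ProbabilityTheory Filter Topology
open scoped ENNReal

namespace Schwartz

section

variable {T X : Type*} [MeasurableSpace T]
  [TopologicalSpace X] [MeasurableSpace X] [BorelSpace X]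

/-- A model `P : T → M(X)` is measurable when it is measurable from the `σ`-algebra of `T`
(below always the Borel one) to the Borel `σ`-algebra of the topology of weak convergence on the space `M(X)` of Borel probability
measures on `X`. -/
def IsMeasurableModel (P : T → ProbabilityMeasure X) : Prop :=
  @Measurable T (ProbabilityMeasure X) _ (borel (ProbabilityMeasure X)) P

/-- A model is dominated when all its members are absolutely continuous with respect to one
`σ`-finite Borel measure. -/
def IsDominatedModel (P : T → ProbabilityMeasure X) : Prop :=
  ∃ ν : Measure X, SigmaFinite ν ∧ ∀ θ, (P θ : Measure X) ≪ ν

/-- The Kullback-Leibler neighborhood `{θ' : K(P θ, P θ') ≤ ε}` of `θ`. -/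
def klNeighborhood (P : T → ProbabilityMeasure X) (ε : ℝ) (θ : T) : Set T :=
  {θ' | InformationTheory.klDiv (P θ : Measure X) (P θ' : Measure X) ≤ ENNReal.ofReal ε}

/-- The prior `π` has Kullback-Leibler support at `θ`. -/
def HasKLSupportAt (P : T → ProbabilityMeasure X) (π : ProbabilityMeasure T) (θ : T) : Prop :=
  ∀ ε : ℝ, 0 < ε → 0 < (π : Measure T) (klNeighborhood P ε θ)

/-- Evaluation on a measurable set is Borel measurable for the weak topology, so a measurable model
is measurable as a map to measures. -/
lemma IsMeasurableModel.measurable_toMeasure [HasOuterApproxClosed X]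
    {P : T → ProbabilityMeasure X} (hP : IsMeasurableModel P) :
    Measurable fun θ => (P θ : Measure X) := by
  refine Measurable.measure_of_isPiSystem_of_isProbabilityMeasure
    (BorelSpace.measurable_eq (α := X)) isPiSystem_isOpen fun U hU => ?_
  let _ : MeasurableSpace (ProbabilityMeasure X) := borel _
  have _ : BorelSpace (ProbabilityMeasure X) := ⟨rfl⟩
  have hlsc : LowerSemicontinuous fun μ : ProbabilityMeasure X => (μ : Measure X) U := by
    rw [lowerSemicontinuous_iff_le_liminf]
    intro μ
    exact ProbabilityMeasure.le_liminf_measure_open_of_tendsto tendsto_id hU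
  exact hlsc.measurable.comp (show Measurable P from hP)

/-- The model `θ ↦ P θ ^ n` of `n` independent samples, as a kernel from `T` to `X ^ n`. -/
noncomputable def iidKernel [HasOuterApproxClosed X] (P : T → ProbabilityMeasure X)
    (hP : IsMeasurableModel P) (n : ℕ) : Kernel T (Fin n → X) where
  toFun θ := Measure.pi fun _ => (P θ : Measure X)
  measurable' := by
    refine Measurable.measure_of_isPiSystem_of_isProbabilityMeasure
      generateFrom_pi.symm isPiSystem_pi ?_
    rintro _ ⟨s, hs, rfl⟩
    simp only [Measure.pi_pi]
    refine Finset.measurable_prod _ fun i _ => ?_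
    exact (Measure.measurable_coe (hs i (Set.mem_univ i))).comp hP.measurable_toMeasure

/-- `post`, written `x ↦ post x`, is a version of the posterior `x ↦ π_x` given `n` samples: a
measurable family of probability measures on `T` (a Markov kernel) which is a regular conditional
distribution of the parameter given the data, where the parameter has law `π` and, given the
parameter `θ`, the data have law `P θ ^ n`. That is, (marginal law of the data) ⊗ `post` is the
joint law of (data, parameter). -/
def IsPosterior [HasOuterApproxClosed X] (P : T → ProbabilityMeasure X) (hP : IsMeasurableModel P)
    (π : ProbabilityMeasure T) (n : ℕ) (post : Kernel (Fin n → X) T) : Prop :=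
  IsMarkovKernel post ∧
    (iidKernel P hP n ∘ₘ (π : Measure T)) ⊗ₘ post =
      ((π : Measure T) ⊗ₘ iidKernel P hP n).map Prod.swap

end

end Schwartz

namespace Schwartz

/-! Write `μ` for the true law and `q θ` for the density of the absolutely continuous part of `P θ`
with respect to `μ`. Since `μ.withDensity (q θ) ≤ P θ`, and likewise for `n`-fold products, the `μ ^
n`-mean of a nonnegative statistic times the evidence `∫ ∏ q θ (x i) dπ` is at most its prior
predictive mean. This inequality replaces Bayes' formula, so any version of the posterior is
allowed.

Let `A` be the parameters under which a bounded statistic has mean at least `ε` above its true mean,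
and `B` the samples with average less than `ε / 2` above it. The prior predictive mean of `1_B *
post A` is `∫_A P θ ^ n (B) dπ`, at most `exp (-n c)` by Hoeffding. Kullback-Leibler support and the
law of large numbers keep the evidence above `exp (-n c / 2)` eventually, and the sample eventually
lies in `B`, so `post A` tends to `0` (`tendsto_posterior_le_integral`).

As `P` is injective and open onto its image, `U` contains the preimage of a weak neighborhood of `P
θ*`; hence finitely many such sets `A` cover its complement. -/

/-- If `μ` with density `q` lies below `ν`, the same holds for the `n`-fold products. -/
lemma withDensity_prod_le_pi {ι X : Type*} [Fintype ι] [MeasurableSpace X] {μ ν : Measure X}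
    [IsProbabilityMeasure μ] [SigmaFinite ν] {q : X → ℝ≥0∞} (hq : Measurable q)
    (h : μ.withDensity q ≤ ν) :
    (Measure.pi fun _ : ι => μ).withDensity (fun x => ∏ i, q (x i)) ≤
      Measure.pi fun _ : ι => ν := by
  have key : ((Measure.pi fun _ : ι => μ).withDensity
      (fun x => ∏ i, q (x i))).toOuterMeasure ≤
        -- `OuterMeasure.pi` is the largest outer measure bounded by the product on boxes, so only
        -- boxes need checking. Their sides may be non-measurable, hence the measurable hulls below.
        OuterMeasure.pi fun _ : ι => ν.toOuterMeasure := by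
    rw [OuterMeasure.le_pi]
    intro s _
    set t : ι → Set X := fun i => toMeasurable ν (s i) with ht
    have htm : ∀ i, MeasurableSet (t i) := fun i => measurableSet_toMeasurable _ _
    calc (Measure.pi fun _ : ι => μ).withDensity (fun x => ∏ i, q (x i)) (Set.univ.pi s)
        ≤ (Measure.pi fun _ : ι => μ).withDensity (fun x => ∏ i, q (x i)) (Set.univ.pi t) :=
          measure_mono (Set.pi_mono fun i _ => subset_toMeasurable _ _)
      _ = ∫⁻ x, ∏ i, (t i).indicator q (x i) ∂(Measure.pi fun _ : ι => μ) := by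
          rw [withDensity_apply _ (.univ_pi htm), ← lintegral_indicator (.univ_pi htm)]
          congr 1 with x
          by_cases hx : x ∈ Set.univ.pi t
          · rw [Set.indicator_of_mem hx]
            exact Finset.prod_congr rfl fun i _ =>
              (Set.indicator_of_mem (hx i (Set.mem_univ i)) _).symm
          · rw [Set.indicator_of_notMem hx]
            simp only [Set.mem_pi, Set.mem_univ, true_imp_iff, not_forall] at hx
            obtain ⟨i, hi⟩ := hx
            exact (Finset.prod_eq_zero (Finset.mem_univ i) (Set.indicator_of_notMem hi _)).symm
      _ = ∏ i, ∫⁻ x, (t i).indicator q x ∂μ := by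
          have hm : ∀ i, Measurable ((t i).indicator q) := fun i => hq.indicator (htm i)
          rw [lintegral_prod_eq_prod_lintegral_of_indepFun Finset.univ
            (fun i (x : ι → X) => (t i).indicator q (x i))
            (iIndepFun_pi fun i => (hm i).aemeasurable)
            (fun i => (hm i).comp (measurable_pi_apply i))]
          refine Finset.prod_congr rfl fun i _ => ?_
          exact (measurePreserving_eval (fun _ : ι => μ) i).lintegral_comp (hm i)
      _ ≤ ∏ i, ν (s i) := by
          refine Finset.prod_le_prod' fun i _ => ?_
          rw [lintegral_indicator (htm i), ← withDensity_apply _ (htm i),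
            ← measure_toMeasurable (s i)]
          exact h _
  refine Measure.le_iff.2 fun s hs => ?_
  refine (key s).trans_eq ?_
  conv_rhs => rw [Measure.pi, toMeasure_apply _ _ hs]

/-! ### Independent samples: law of large numbers, likelihood ratios, Hoeffding's inequality. -/

section Infinite

variable {X : Type*} [MeasurableSpace X] (μ : Measure X) [IsProbabilityMeasure μ]

lemma measurePreserving_infinitePi_fin (n : ℕ) :
    MeasurePreserving (fun (x : ℕ → X) (i : Fin n) => x i)
      (Measure.infinitePi fun _ : ℕ => μ) (Measure.pi fun _ : Fin n => μ) := by
  refine ⟨by fun_prop, ?_⟩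
  rw [Measure.map_infinitePi_infinitePi_of_inj (f := fun i : Fin n => (i : ℕ))
    Fin.val_injective, Measure.infinitePi_eq_pi]

lemma strong_law_infinitePi {g : X → ℝ} (hg : Measurable g) (hint : Integrable g μ) :
    ∀ᵐ x ∂(Measure.infinitePi fun _ : ℕ => μ),
      Tendsto (fun n : ℕ => (∑ i ∈ Finset.range n, g (x i)) / n) atTop (𝓝 (∫ y, g y ∂μ)) := by
  have hmp : ∀ i : ℕ, MeasurePreserving (fun x : ℕ → X => x i)
      (Measure.infinitePi fun _ : ℕ => μ) μ := fun i =>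
    measurePreserving_eval_infinitePi (fun _ : ℕ => μ) i
  have h := strong_law_ae_real (μ := Measure.infinitePi fun _ : ℕ => μ)
    (fun i x => g (x i)) ((hmp 0).integrable_comp_of_integrable hint)
    (fun i j hij => (iIndepFun_infinitePi (X := fun _ => g) fun _ => hg).indepFun hij)
    (fun i => ⟨(hg.comp (measurable_pi_apply i)).aemeasurable,
      (hg.comp (measurable_pi_apply 0)).aemeasurable, by
        rw [← Function.comp_def g, ← Function.comp_def g, ← Measure.map_map hg (by fun_prop),
          ← Measure.map_map hg (by fun_prop), (hmp i).map_eq, (hmp 0).map_eq]⟩)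
  have h0 : ∫ x, g (x 0) ∂(Measure.infinitePi fun _ : ℕ => μ) = ∫ y, g y ∂μ := by
    conv_rhs => rw [← (hmp 0).map_eq]
    rw [integral_map (hmp 0).aemeasurable hg.aestronglyMeasurable]
  rwa [h0] at h

lemma ae_infinitePi_forall {p : X → Prop} (h : ∀ᵐ y ∂μ, p y) :
    ∀ᵐ x ∂(Measure.infinitePi fun _ : ℕ => μ), ∀ i, p (x i) :=
  ae_all_iff.2 fun i =>
    (measurePreserving_eval_infinitePi (fun _ : ℕ => μ) i).quasiMeasurePreserving.ae h

/-- Under a Kullback-Leibler bound, likelihood ratios decay at most exponentially. -/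
lemma tendsto_exp_mul_prod_of_klDiv_le {ν : Measure X} [IsProbabilityMeasure ν] {ε β : ℝ}
    (hε : 0 ≤ ε) (hβ : ε < β) (hkl : InformationTheory.klDiv μ ν ≤ ENNReal.ofReal ε)
    {q : X → ℝ≥0∞} (hq : q =ᵐ[μ] ν.rnDeriv μ) :
    ∀ᵐ x ∂(Measure.infinitePi fun _ : ℕ => μ),
      Tendsto (fun n : ℕ => ENNReal.ofReal (Real.exp (n * β)) * ∏ i : Fin n, q (x i))
        atTop (𝓝 ∞) := by
  obtain ⟨hac, hint⟩ :=
    InformationTheory.klDiv_ne_top_iff.1 (ne_top_of_le_ne_top ENNReal.ofReal_ne_top hkl)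
  have hle : ∫ y, llr μ ν y ∂μ ≤ ε := by
    rw [← InformationTheory.toReal_klDiv_of_measure_eq hac (by simp)]
    exact ENNReal.toReal_le_of_le_ofReal hε hkl
  -- Since `μ ≪ ν`, the density of `ν` is `μ`-almost everywhere positive and the reciprocal of
  -- `dμ/dν`; thus no logarithm degenerates.
  have hqe : ∀ᵐ y ∂μ, q y = ENNReal.ofReal (Real.exp (-llr μ ν y)) := by
    filter_upwards [hq, exp_neg_llr hac, hac.ae_le (Measure.rnDeriv_lt_top μ ν),
      Measure.rnDeriv_pos hac, Measure.inv_rnDeriv hac] with y h1 h2 _ h4 h5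
    rw [h2, h1, ENNReal.ofReal_toReal]
    rw [← h5]
    simpa using h4.ne'
  filter_upwards [ae_infinitePi_forall μ hqe,
    strong_law_infinitePi μ (measurable_llr μ ν) hint] with x hx hlim
  have heq : ∀ n : ℕ, ENNReal.ofReal (Real.exp (n * β)) * ∏ i : Fin n, q (x i) =
      ENNReal.ofReal (Real.exp (n * β - ∑ i ∈ Finset.range n, llr μ ν (x i))) := by
    intro n
    rw [Finset.prod_congr rfl fun (i : Fin n) _ => hx i, ← ENNReal.ofReal_prod_of_nonneg
      fun i _ => (Real.exp_pos _).le, ← ENNReal.ofReal_mul (Real.exp_pos _).le, ← Real.exp_sum,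
      ← Real.exp_add, Finset.sum_neg_distrib, ← sub_eq_add_neg,
      Fin.sum_univ_eq_sum_range (fun i => llr μ ν (x i)) n]
  simp_rw [heq]
  refine ENNReal.tendsto_ofReal_nhds_top.2 (Real.tendsto_exp_atTop.comp ?_)
  have h1 : Tendsto (fun n : ℕ => β - (∑ i ∈ Finset.range n, llr μ ν (x i)) / n) atTop
      (𝓝 (β - ∫ y, llr μ ν y ∂μ)) := tendsto_const_nhds.sub hlim
  refine (tendsto_natCast_atTop_atTop.atTop_mul_pos (by linarith) h1).congr' ?_
  filter_upwards [eventually_gt_atTop 0] with n hn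
  have : (n : ℝ) ≠ 0 := by positivity
  field_simp

/-- Hoeffding's inequality for the lower tail of an empirical mean. -/
lemma pi_sum_lt_le {g : X → ℝ} (hg : Measurable g) {a b : ℝ} (hab : a < b)
    (hmem : ∀ y, g y ∈ Set.Icc a b) {m ε : ℝ} (hε : 0 < ε) (hm : m + ε ≤ ∫ y, g y ∂μ) (n : ℕ) :
    (Measure.pi fun _ : Fin n => μ) {x | ∑ i, g (x i) < n * (m + ε / 2)} ≤
      ENNReal.ofReal (Real.exp (-(n * (ε ^ 2 / (2 * (b - a) ^ 2))))) := by
  set Y : Fin n → (Fin n → X) → ℝ := fun i x => (∫ y, g y ∂μ) - g (x i) with hY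
  have hYm : ∀ _ : Fin n, Measurable fun y => (∫ y, g y ∂μ) - g y := fun _ =>
    measurable_const.sub hg
  have hind : iIndepFun Y (Measure.pi fun _ : Fin n => μ) :=
    iIndepFun_pi (X := fun _ y => (∫ y, g y ∂μ) - g y) fun i => (hYm i).aemeasurable
  have hsub : ∀ i ∈ Finset.univ, HasSubgaussianMGF (Y i) ((‖b - a‖₊ / 2) ^ 2)
      (Measure.pi fun _ : Fin n => μ) := by
    intro i _
    have h := (hasSubgaussianMGF_of_mem_Icc (μ := Measure.pi fun _ : Fin n => μ)
      (X := fun x => g (x i)) (hg.comp (measurable_pi_apply i)).aemeasurable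
      (ae_of_all _ fun x => hmem (x i))).neg
    have h0 : ∫ x, g (x i) ∂(Measure.pi fun _ : Fin n => μ) = ∫ y, g y ∂μ := by
      conv_rhs => rw [← (measurePreserving_eval (fun _ : Fin n => μ) i).map_eq]
      rw [integral_map (measurable_pi_apply i).aemeasurable hg.aestronglyMeasurable]
    convert h using 1
    ext x
    simp [hY, h0]
  -- Deviation `n ε / 2` against total variance proxy `n (b - a) ^ 2 / 4` gives the stated exponent.
  have hbound := HasSubgaussianMGF.measure_sum_ge_le_of_iIndepFun hind hsub
    (ε := n * (ε / 2)) (by positivity)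
  rw [measureReal_def, ← ENNReal.le_ofReal_iff_toReal_le (measure_ne_top _ _)
    (Real.exp_pos _).le] at hbound
  refine ((measure_mono fun x hx => ?_).trans hbound).trans_eq ?_
  · simp only [Set.mem_ofPred_eq, hY, Finset.sum_sub_distrib, Finset.sum_const, Finset.card_univ,
      Fintype.card_fin, nsmul_eq_mul] at hx ⊢
    have := mul_le_mul_of_nonneg_left hm (Nat.cast_nonneg (α := ℝ) n)
    linarith
  · congr 2
    have hba : b - a ≠ 0 := (sub_pos.2 hab).ne'
    rcases Nat.eq_zero_or_pos n with rfl | hn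
    · simp
    · have hn' : (n : ℝ) ≠ 0 := by positivity
      simp only [Finset.sum_const, Finset.card_univ, Fintype.card_fin, nsmul_eq_mul,
        NNReal.coe_mul, NNReal.coe_natCast, NNReal.coe_pow, NNReal.coe_div, coe_nnnorm,
        Real.norm_eq_abs, NNReal.coe_ofNat, div_pow, sq_abs]
      field_simp

end Infinite
-- Bounds on the evidence from below and on statistics relative to it.
section Kernel

variable {T X : Type*} [MeasurableSpace T] [MeasurableSpace X]

/-- The likelihood of the sample `x`, averaged over the prior `π`, for densities `q θ`. -/
noncomputable def evidence (q : T → X → ℝ≥0∞) (π : Measure T) (n : ℕ) (x : Fin n → X) : ℝ≥0∞ :=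
  ∫⁻ θ, ∏ i, q θ (x i) ∂π

lemma measurable_prod_density {q : T → X → ℝ≥0∞} (hq : Measurable (Function.uncurry q))
    (n : ℕ) :
    Measurable fun z : T × (Fin n → X) => ∏ i, q z.1 (z.2 i) :=
  Finset.measurable_prod _ fun i _ => hq.comp
    (measurable_fst.prodMk ((measurable_pi_apply i).comp measurable_snd))

lemma measurable_evidence {q : T → X → ℝ≥0∞} (hq : Measurable (Function.uncurry q))
    (π : Measure T) [SFinite π] (n : ℕ) : Measurable (evidence q π n) :=
  (measurable_prod_density hq n).lintegral_prod_left'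

/-- If the likelihood beats `exp (- n β)` for a non-null set of parameters, then so does the
evidence. -/
lemma tendsto_exp_mul_evidence {q : T → X → ℝ≥0∞} (hq : Measurable (Function.uncurry q))
    (μ : Measure X) [IsProbabilityMeasure μ] (π : Measure T) [SFinite π]
    {β : ℝ} {K : Set T} (hK : π K ≠ 0)
    (hlim : ∀ θ ∈ K, ∀ᵐ x ∂(Measure.infinitePi fun _ : ℕ => μ),
      Tendsto (fun n : ℕ => ENNReal.ofReal (Real.exp (n * β)) * ∏ i : Fin n, q θ (x i))
        atTop (𝓝 ∞)) :
    ∀ᵐ x ∂(Measure.infinitePi fun _ : ℕ => μ),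
      Tendsto (fun n : ℕ => ENNReal.ofReal (Real.exp (n * β)) * evidence q π n fun i => x i)
        atTop (𝓝 ∞) := by
  set F : ℕ → T × (ℕ → X) → ℝ≥0∞ := fun n z =>
    ENNReal.ofReal (Real.exp (n * β)) * ∏ i : Fin n, q z.1 (z.2 i) with hF
  have hFm : ∀ n, Measurable (F n) := fun n => by
    refine ((measurable_prod_density hq n).comp (measurable_fst.prodMk
      (f := fun z : T × (ℕ → X) => z.1) (g := fun z (i : Fin n) => z.2 i) ?_)).const_mul _
    fun_prop
  set G : Set (T × (ℕ → X)) := {z | Tendsto (fun n => F n z) atTop (𝓝 ∞)} with hG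
  have hGm : MeasurableSet G := measurableSet_tendsto _ hFm
  -- `K` need not be measurable; `K'` is a measurable set containing it on which the limit still
  -- holds almost surely, so Fubini and then Fatou apply.
  set K' : Set T := {θ | Measure.infinitePi (fun _ : ℕ => μ) (Prod.mk θ ⁻¹' Gᶜ) = 0} with hK'
  have hK'm : MeasurableSet K' :=
    measurable_measure_prodMk_left hGm.compl (measurableSet_singleton 0)
  have hKK' : K ⊆ K' := fun θ hθ => hlim θ hθ
  have hπ : π K' ≠ 0 := fun h => hK (measure_mono_null hKK' h)
  have hae : ∀ᵐ x ∂(Measure.infinitePi fun _ : ℕ => μ), ∀ᵐ θ ∂(π.restrict K'), (θ, x) ∈ G := by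
    rw [← Measure.ae_ae_comm hGm]
    exact (ae_restrict_iff' hK'm).2 (ae_of_all _ fun θ hθ => hθ)
  filter_upwards [hae] with x hx
  have hmx : ∀ n, Measurable fun θ => F n (θ, x) := fun n =>
    (hFm n).comp measurable_prodMk_right
  have htop : ∫⁻ θ in K', liminf (fun n => F n (θ, x)) atTop ∂π = ∞ := by
    rw [lintegral_congr_ae (g := fun _ => ∞) (hx.mono fun θ hθ => Tendsto.liminf_eq hθ)]
    simp [ENNReal.top_mul, hπ]
  have hliminf : liminf (fun n => ∫⁻ θ in K', F n (θ, x) ∂π) atTop = ∞ :=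
    top_le_iff.1 (htop.symm.trans_le (lintegral_liminf_le hmx))
  have ht : Tendsto (fun n => ∫⁻ θ in K', F n (θ, x) ∂π) atTop (𝓝 ∞) :=
    tendsto_of_le_liminf_of_limsup_le hliminf.ge le_top
  refine tendsto_nhds_top_mono ht (Eventually.of_forall fun n => ?_)
  refine (setLIntegral_le_lintegral _ _).trans_eq ?_
  exact lintegral_const_mul' _ _ ENNReal.ofReal_ne_top

/-- Statistics whose mean under the prior predictive law decays exponentially are, along almost
every sequence sampled from `μ`, exponentially small relative to the evidence. -/
lemma tendsto_exp_mul_mul_evidence {q : T → X → ℝ≥0∞} (hq : Measurable (Function.uncurry q))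
    (μ : Measure X) [IsProbabilityMeasure μ] (π : Measure T)
    [SFinite π] (κ : Kernel T X) [IsMarkovKernel κ] (hle : ∀ θ, μ.withDensity (q θ) ≤ κ θ)
    {h : (n : ℕ) → (Fin n → X) → ℝ≥0∞} (hh : ∀ n, Measurable (h n)) {c : ℝ} (hc : 0 < c)
    (hbound : ∀ n : ℕ, ∫⁻ θ, ∫⁻ x, h n x ∂(Measure.pi fun _ => κ θ) ∂π ≤
      ENNReal.ofReal (Real.exp (-(n * c)))) :
    ∀ᵐ x ∂(Measure.infinitePi fun _ : ℕ => μ),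
      Tendsto (fun n : ℕ => ENNReal.ofReal (Real.exp (n * (c / 2))) *
        (h n (fun i => x i) * evidence q π n fun i => x i)) atTop (𝓝 0) := by
  have hmean : ∀ n, ∫⁻ x, h n (fun i => x i) * evidence q π n (fun i => x i)
      ∂(Measure.infinitePi fun _ : ℕ => μ) ≤ ENNReal.ofReal (Real.exp (-(n * c))) := by
    intro n
    have hP := measurable_prod_density hq n
    calc ∫⁻ x, h n (fun i => x i) * evidence q π n (fun i => x i)
          ∂(Measure.infinitePi fun _ : ℕ => μ)
        = ∫⁻ x, h n x * evidence q π n x ∂(Measure.pi fun _ => μ) :=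
          (measurePreserving_infinitePi_fin μ n).lintegral_comp
            ((hh n).mul (measurable_evidence hq π n))
      _ = ∫⁻ x, ∫⁻ θ, h n x * ∏ i, q θ (x i) ∂π ∂(Measure.pi fun _ => μ) := by
          congr 1 with x
          exact (lintegral_const_mul _ (hP.comp measurable_prodMk_right)).symm
      _ = ∫⁻ θ, ∫⁻ x, h n x * ∏ i, q θ (x i) ∂(Measure.pi fun _ => μ) ∂π :=
          lintegral_lintegral_swap (((hh n).comp measurable_fst).mul
            (hP.comp measurable_swap)).aemeasurable
      _ ≤ ∫⁻ θ, ∫⁻ x, h n x ∂(Measure.pi fun _ => κ θ) ∂π := by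
          refine lintegral_mono fun θ => ?_
          have hθ : Measurable (q θ) := hq.comp measurable_prodMk_left
          calc ∫⁻ x, h n x * ∏ i, q θ (x i) ∂(Measure.pi fun _ => μ)
              = ∫⁻ x, h n x ∂((Measure.pi fun _ => μ).withDensity fun x => ∏ i, q θ (x i)) := by
                have hθn : Measurable fun x : Fin n → X => ∏ i, q θ (x i) :=
                  hP.comp measurable_prodMk_left
                rw [lintegral_withDensity_eq_lintegral_mul _ hθn (hh n)]
                simp only [Pi.mul_apply, mul_comm]
            _ ≤ _ := lintegral_mono' (withDensity_prod_le_pi hθ (hle θ)) le_rfl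
      _ ≤ _ := hbound n
  set u : ℕ → (ℕ → X) → ℝ≥0∞ := fun n x => ENNReal.ofReal (Real.exp (n * (c / 2))) *
        (h n (fun i => x i) * evidence q π n fun i => x i) with hu
  have hvm : ∀ n, Measurable fun x : ℕ → X =>
      h n (fun i => x i) * evidence q π n fun i => x i := fun n =>
    ((hh n).mul (measurable_evidence hq π n)).comp
      (measurePreserving_infinitePi_fin μ n).measurable
  have hum : ∀ n, Measurable (u n) := fun n => (hvm n).const_mul _
  -- The factor `exp (n c / 2)` uses up half of the decay rate `c`; the rest makes the means
  -- summable, so the series converges almost surely and its terms vanish.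
  have hsum : ∫⁻ x, ∑' n, u n x ∂(Measure.infinitePi fun _ : ℕ => μ) ≠ ∞ := by
    rw [lintegral_tsum fun n => (hum n).aemeasurable]
    have hn : ∀ n, ∫⁻ x, u n x ∂(Measure.infinitePi fun _ : ℕ => μ) ≤
        ENNReal.ofReal (Real.exp (n * -(c / 2))) := fun n => by
      rw [lintegral_const_mul _ (hvm n)]
      refine (mul_le_mul_right (hmean n) _).trans_eq ?_
      rw [← ENNReal.ofReal_mul (Real.exp_pos _).le, ← Real.exp_add]
      ring_nf
    refine ne_top_of_le_ne_top ?_ (ENNReal.tsum_le_tsum hn)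
    exact (Real.summable_exp_nat_mul_iff.2 (by linarith)).tsum_ofReal_ne_top
  filter_upwards [ae_lt_top (Measurable.tsum hum) hsum] with x hx
  exact ENNReal.tendsto_atTop_zero_of_tsum_ne_top hx.ne

end Kernel

/-! ### Weak neighborhoods and posterior mass. -/

section Consistency

variable {T X : Type*} [MeasurableSpace T]
  [TopologicalSpace X] [MeasurableSpace X] [BorelSpace X]

/-- Weak neighborhoods contain those given by finitely many bounded continuous functions. -/
lemma exists_finset_integral_of_mem_nhds {p : ProbabilityMeasure X}
    {W : Set (ProbabilityMeasure X)} (hW : W ∈ 𝓝 p) :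
    ∃ (I : Finset (BoundedContinuousFunction X ℝ)) (δ : BoundedContinuousFunction X ℝ → ℝ),
      (∀ f, 0 < δ f) ∧ ∀ Q : ProbabilityMeasure X,
        (∀ f ∈ I, |∫ x, f x ∂(Q : Measure X) - ∫ x, f x ∂(p : Measure X)| < δ f) → Q ∈ W := by
  set Φ : ProbabilityMeasure X → BoundedContinuousFunction X ℝ → ℝ := fun Q f =>
    ∫ x, f x ∂(Q : Measure X) with hΦ
  have hle : comap Φ (𝓝 (Φ p)) ≤ 𝓝 p := by
    rw [← tendsto_id', ProbabilityMeasure.tendsto_iff_forall_integral_tendsto]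
    intro f
    exact ((continuous_apply f).tendsto (Φ p)).comp tendsto_comap
  obtain ⟨t, ht, htW⟩ := mem_comap.1 (hle hW)
  rw [nhds_pi] at ht
  obtain ⟨I, s, hs, hst⟩ := mem_pi'.1 ht
  choose δ hδ hδs using fun f => Metric.mem_nhds_iff.1 (hs f)
  refine ⟨I, δ, hδ, fun Q hQ => htW (hst fun f hf => hδs f ?_)⟩
  rw [Metric.mem_ball, Real.dist_eq]
  exact hQ f hf

variable [HasOuterApproxClosed X] {P : T → ProbabilityMeasure X}

instance (hP : IsMeasurableModel P) (n : ℕ) : IsMarkovKernel (iidKernel P hP n) :=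
  ⟨fun θ => inferInstanceAs (IsProbabilityMeasure (Measure.pi fun _ => (P θ : Measure X)))⟩

/-- Both sides are the joint probability that the parameter lies in `A` and the data in `B`. The
joint-law identity defining the posterior enters only here. -/
lemma IsPosterior.lintegral_lintegral_indicator {hP : IsMeasurableModel P}
    {π : ProbabilityMeasure T} {n : ℕ} {post : Kernel (Fin n → X) T}
    (h : IsPosterior P hP π n post) {A : Set T} (hA : MeasurableSet A) {B : Set (Fin n → X)}
    (hB : MeasurableSet B) :
    ∫⁻ θ, ∫⁻ x, B.indicator (fun x => post x A) x ∂(Measure.pi fun _ => (P θ : Measure X)) ∂π =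
      ∫⁻ θ in A, Measure.pi (fun _ => (P θ : Measure X)) B ∂π := by
  obtain ⟨_, hjoint⟩ := h
  have hm : Measurable (B.indicator fun x => post x A) := (post.measurable_coe hA).indicator hB
  calc _ = ∫⁻ x, B.indicator (fun x => post x A) x ∂(iidKernel P hP n ∘ₘ (π : Measure T)) :=
        (Measure.lintegral_bind (Kernel.aemeasurable _) hm.aemeasurable).symm
    _ = ((iidKernel P hP n ∘ₘ (π : Measure T)) ⊗ₘ post) (B ×ˢ A) := by
        rw [lintegral_indicator hB, Measure.compProd_apply_prod hB hA]
    _ = ((π : Measure T) ⊗ₘ iidKernel P hP n) (A ×ˢ B) := by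
        rw [hjoint, Measure.map_apply measurable_swap (hB.prod hA), Set.preimage_swap_prod]
    _ = _ := by
        rw [Measure.compProd_apply_prod hA hB]
        rfl

lemma IsMeasurableModel.measurableSet_le_integral (hP : IsMeasurableModel P) {g : X → ℝ}
    (hg : Measurable g) (r : ℝ) : MeasurableSet {θ | r ≤ ∫ x, g x ∂(P θ : Measure X)} := by
  let κ : Kernel T X := ⟨fun θ => (P θ : Measure X), hP.measurable_toMeasure⟩
  have h : StronglyMeasurable fun θ => ∫ x, g x ∂(κ θ) := hg.stronglyMeasurable.integral_kernel
  exact measurableSet_le measurable_const h.measurable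

/-- Under Kullback-Leibler support, the posterior mass of the parameters under which a bounded
statistic has a mean exceeding its true mean by a fixed amount vanishes. -/
lemma tendsto_posterior_le_integral [MeasurableSpace.CountablyGenerated X]
    (hP : IsMeasurableModel P) {π : ProbabilityMeasure T} {θ₀ : T} (hKL : HasKLSupportAt P π θ₀)
    {post : (n : ℕ) → Kernel (Fin n → X) T} (hpost : ∀ n, IsPosterior P hP π n (post n))
    {g : X → ℝ} (hg : Measurable g) {a b : ℝ} (hab : a < b) (hmem : ∀ y, g y ∈ Set.Icc a b)
    {ε : ℝ} (hε : 0 < ε) :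
    ∀ᵐ x ∂(Measure.infinitePi fun _ : ℕ => (P θ₀ : Measure X)),
      Tendsto (fun n : ℕ => post n (fun i : Fin n => x i)
        {θ | ∫ y, g y ∂(P θ₀ : Measure X) + ε ≤ ∫ y, g y ∂(P θ : Measure X)}) atTop (𝓝 0) := by
  set μ : Measure X := (P θ₀ : Measure X) with hμ
  set A : Set T := {θ | ∫ y, g y ∂μ + ε ≤ ∫ y, g y ∂(P θ : Measure X)} with hA
  have hAm : MeasurableSet A := hP.measurableSet_le_integral hg _
  let κ : Kernel T X := ⟨fun θ => (P θ : Measure X), hP.measurable_toMeasure⟩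
  have : IsMarkovKernel κ := ⟨fun θ => inferInstanceAs (IsProbabilityMeasure (P θ : Measure X))⟩
  set q : T → X → ℝ≥0∞ := Kernel.rnDeriv κ (Kernel.const T μ) with hqdef
  have hq : Measurable (Function.uncurry q) := Kernel.measurable_rnDeriv κ _
  have hqθ : ∀ θ, q θ =ᵐ[μ] (P θ : Measure X).rnDeriv μ := fun θ =>
    Kernel.rnDeriv_eq_rnDeriv_measure (κ := κ) (η := Kernel.const T μ) (a := θ)
  have hle : ∀ θ, μ.withDensity (q θ) ≤ κ θ := fun θ => by
    rw [withDensity_congr_ae (hqθ θ)]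
    exact Measure.withDensity_rnDeriv_le _ _
  set c : ℝ := ε ^ 2 / (2 * (b - a) ^ 2) with hcdef
  have hc : 0 < c := div_pos (by positivity) (by have := sub_pos.2 hab; positivity)
  set B : (n : ℕ) → Set (Fin n → X) := fun n =>
    {x | ∑ i, g (x i) < n * (∫ y, g y ∂μ + ε / 2)} with hB
  have hBm : ∀ n, MeasurableSet (B n) := fun n =>
    measurableSet_lt (by fun_prop) measurable_const
  have hbound : ∀ n : ℕ, ∫⁻ θ, ∫⁻ x, (B n).indicator (fun x => post n x A) x
      ∂(Measure.pi fun _ => κ θ) ∂π ≤ ENNReal.ofReal (Real.exp (-(n * c))) := fun n => by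
    refine ((hpost n).lintegral_lintegral_indicator hAm (hBm n)).trans_le ?_
    calc ∫⁻ θ in A, Measure.pi (fun _ => (P θ : Measure X)) (B n) ∂π
        ≤ ∫⁻ _ in A, ENNReal.ofReal (Real.exp (-(n * c))) ∂π :=
          setLIntegral_mono measurable_const fun θ hθ => pi_sum_lt_le _ hg hab hmem hε hθ n
      _ ≤ _ := by
          rw [setLIntegral_const]
          exact mul_le_of_le_one_right' prob_le_one
  -- Any radius below `c / 2` would do: the evidence must beat `exp (-n c / 2)`, the rate in `hnum`.
  have hK := (hKL (c / 4) (by positivity)).ne'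
  have hev := tendsto_exp_mul_evidence hq μ (π : Measure T) (β := c / 2) hK fun θ hθ =>
    tendsto_exp_mul_prod_of_klDiv_le μ (by positivity) (by linarith) hθ (hqθ θ)
  have hnum := tendsto_exp_mul_mul_evidence hq μ (π : Measure T) κ hle
    (fun n => ((post n).measurable_coe hAm).indicator (hBm n)) hc hbound
  have hint : Integrable g μ := Integrable.of_mem_Icc a b hg.aemeasurable (ae_of_all _ hmem)
  filter_upwards [hev, hnum, strong_law_infinitePi μ hg hint] with x h1 h2 h3
  refine tendsto_of_tendsto_of_tendsto_of_le_of_le' tendsto_const_nhds h2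
    (Eventually.of_forall fun _ => zero_le) ?_
  filter_upwards [h1.eventually (le_mem_nhds ENNReal.one_lt_top),
    h3.eventually_lt_const (u := ∫ y, g y ∂μ + ε / 2) (by linarith),
    eventually_gt_atTop 0] with n hn1 hn3 hn0
  have hmemB : (fun i : Fin n => x i) ∈ B n := by
    have hn : (0 : ℝ) < n := by exact_mod_cast hn0
    rw [div_lt_iff₀ hn] at hn3
    change ∑ i : Fin n, g (x i) < _
    rw [Fin.sum_univ_eq_sum_range (fun i => g (x i)) n]
    linarith
  rw [Set.indicator_of_mem hmemB, mul_left_comm]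
  exact le_mul_of_one_le_right' hn1

end Consistency

end Schwartz

/-! ### From weak neighborhoods to neighborhoods of the parameter. -/

theorem corollary3p1
    {E F : Type*}
    [TopologicalSpace E] [PolishSpace E] [MeasurableSpace E] [BorelSpace E]
    [TopologicalSpace F] [PolishSpace F] [MeasurableSpace F] [BorelSpace F]
    (X : Set E) (hX : MeasurableSet X) (Θ : Set F) (hΘ : MeasurableSet Θ)
    (P : Θ → ProbabilityMeasure X)
    (hinj : Function.Injective P)
    (hP : Schwartz.IsMeasurableModel P)
    (hdom : Schwartz.IsDominatedModel P)
    (hopen : IsOpenMap (Set.rangeFactorization P))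
    (π : ProbabilityMeasure Θ) (θstar : Θ)
    (hKL : Schwartz.HasKLSupportAt P π θstar)
    (post : (n : ℕ) → Kernel (Fin n → X) Θ)
    (hpost : ∀ n, Schwartz.IsPosterior P hP π n (post n))
    (U : Set Θ) (hU : MeasurableSet U) (hUnhds : U ∈ 𝓝 θstar) :
    ∀ᵐ x : ℕ → X ∂(Measure.infinitePi fun _ : ℕ => (P θstar : Measure X)),
      Tendsto (fun n : ℕ => post n (fun i : Fin n => x i) U) atTop (𝓝 1) := by
  obtain ⟨W, hW, hWU⟩ := mem_nhds_subtype _ _ _ |>.1 (hopen.image_mem_nhds hUnhds)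
  have hWU' : ∀ θ, P θ ∈ W → θ ∈ U := fun θ hθ => by
    obtain ⟨u, hu, hue⟩ := hWU (a := Set.rangeFactorization P θ) hθ
    rwa [← hinj (congrArg Subtype.val hue)]
  obtain ⟨I, δ, hδ, hI⟩ := Schwartz.exists_finset_integral_of_mem_nhds (p := P θstar) hW
  set A : (X → ℝ) → ℝ → Set Θ := fun g ε =>
    {θ | ∫ y, g y ∂(P θstar : Measure X) + ε ≤ ∫ y, g y ∂(P θ : Measure X)} with hA
  -- Using both `f` and `-f` turns the two-sided deviation into one-sided ones.
  have hcover : Uᶜ ⊆ ⋃ f ∈ I, (A f (δ f) ∪ A (-f) (δ f)) := by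
    intro θ hθ
    by_contra hcon
    refine hθ (hWU' θ (hI _ fun f hf => ?_))
    simp only [Set.mem_iUnion, not_exists] at hcon
    have h := hcon f hf
    simp only [hA, Set.mem_union, Set.mem_ofPred_eq, Pi.neg_apply, integral_neg, not_or,
      not_le] at h
    exact abs_lt.2 ⟨by linarith [h.2], by linarith [h.1]⟩
  have hlim : ∀ f ∈ I, ∀ᵐ x ∂(Measure.infinitePi fun _ : ℕ => (P θstar : Measure X)),
      Tendsto (fun n : ℕ => post n (fun i : Fin n => x i) (A f (δ f)) +
        post n (fun i : Fin n => x i) (A (-f) (δ f))) atTop (𝓝 0) := by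
    intro f _
    -- The `+ 1` keeps the interval nondegenerate when `f = 0`.
    have hb : ∀ y, |f y| ≤ ‖f‖ + 1 := fun y => (f.norm_coe_le_norm y).trans (by linarith)
    have hlt : -(‖f‖ + 1) < ‖f‖ + 1 := by linarith [norm_nonneg f]
    have hm : Measurable f := f.continuous.measurable
    filter_upwards [Schwartz.tendsto_posterior_le_integral hP hKL hpost hm hlt
        (fun y => abs_le.1 (hb y)) (hδ f),
      Schwartz.tendsto_posterior_le_integral hP hKL hpost hm.neg hlt
        (fun y => abs_le.1 ((abs_neg (f y)).trans_le (hb y))) (hδ f)] with x h1 h2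
    rw [← add_zero (0 : ℝ≥0∞)]
    exact h1.add h2
  filter_upwards [(ae_ball_iff I.countable_toSet).2 hlim] with x hx
  have hsum : Tendsto (fun n : ℕ => ∑ f ∈ I, (post n (fun i : Fin n => x i) (A f (δ f)) +
      post n (fun i : Fin n => x i) (A (-f) (δ f)))) atTop (𝓝 0) := by
    simpa using tendsto_finsetSum I hx
  have hcompl : Tendsto (fun n : ℕ => post n (fun i : Fin n => x i) Uᶜ) atTop (𝓝 0) := by
    refine tendsto_of_tendsto_of_tendsto_of_le_of_le tendsto_const_nhds hsum
      (fun _ => zero_le) fun n => ?_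
    refine (measure_mono hcover).trans ((measure_biUnion_finset_le _ _).trans ?_)
    exact Finset.sum_le_sum fun f _ => measure_union_le _ _
  have hone := ENNReal.Tendsto.sub (tendsto_const_nhds (x := (1 : ℝ≥0∞))) hcompl
    (Or.inl ENNReal.one_ne_top)
  rw [tsub_zero] at hone
  refine hone.congr fun n => ?_
  have := (hpost n).1
  rw [← prob_compl_eq_one_sub hU.compl, compl_compl]
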